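/- All cardinals are infinite, and a cardinal is identified with its initial ordinal. For cardinals $\theta\le\mu$ let $[\mu]^\theta$ be the set of subsets of $\mu$ of cardinality $\theta$, let $\overline{[\mu]^\theta}=\{X\in[\mu]^\theta : |X\cap\alpha|<\theta \text{ for all } \alpha<\mu\}$, and let $\underline{[\mu]^\theta}=\bigcup_{\alpha<\mu}[\alpha]^\theta$ be the set of those $X\in[\mu]^\theta$ that are bounded in $\mu$. For a partially ordered set $P$, a set $D\subseteq P$ is dense if every element of $P$ is above some element of $D$; $\mathcal D(P)$ is the least cardinality of a dense subset of $P$; and $\mathcal A\subseteq P$ is an antichain if no two distinct elements of $\mathcal A$ have a common lower bound in $P$. Write $\underline{\mathcal D(\mu,\theta)}=\mathcal D(\underline{[\mu]^\theta},\subseteq)$ (the lower $\theta$-density of $\mu$). For regular $\kappa<\theta$ let $S^\theta_\kappa=\{i<\theta:\operatorname{cf} i=\kappa\}$ and let $\mathcal S^\theta_\kappa$ be the family of all subsets of $S^\theta_\kappa$ that are stationary in $\theta$. For a cardinal $\lambda=\aleph_\alpha$ and an ordinal $\gamma$ let $\lambda^{+\gamma}=\aleph_{\alpha+\gamma}$.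 **Theorem.** Suppose $\kappa=\operatorname{cf}\kappa<\theta=\operatorname{cf}\mu<\mu$ and $\langle\kappa_i:i<\theta\rangle$ is a strictly increasing and continuous sequence of cardinals with limit $\mu$ and $\theta<\kappa_0$. Let $\mathcal A\subseteq\overline{[\mu]^\theta}$ be an antichain in $\langle\overline{[\mu]^\theta},\subseteq\rangle$ and let $\gamma<\theta$ be an ordinal. Suppose that there is a sequence $\langle\mathcal D_i:i\in S^\theta_\kappa\rangle$ such that 1. $\mathcal D_i\subseteq\overline{[\kappa_i]^\kappa}$ and $|\mathcal D_i|\le\kappa_i^{+\gamma}$ for all $i\in S^\theta_\kappa$; 2. for every $A\in\mathcal A$ the set $\{i\in S^\theta_\kappa:(\exists X\in\mathcal D_i)\,X\subseteq A\}$ is stationary in $\theta$. Then $$|\mathcal A|\le\mu^{+\gamma}+\underline{\mathcal D(\mu,\theta)}+\mathcal D(\mathcal S^\theta_\kappa,\subseteq).$$ -/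

import Mathlib

universe u

open Cardinal Ordinal Set

noncomputable section

namespace DensityArithmetic

/-- `A` is dense in `B`: every member of `B` lies above some member of `A`. -/
def IsDenseIn {P : Type u} [PartialOrder P] (A B : Set P) : Prop :=
  ∀ y ∈ B, ∃ x ∈ A, x ≤ y

/-- The density of the suborder `B` of `P`: the least cardinality of a subset of `B` that is
dense in `B`. -/
def density {P : Type u} [PartialOrder P] (B : Set P) : Cardinal.{u} :=
  sInf {c | ∃ A : Set P, A ⊆ B ∧ IsDenseIn A B ∧ #A = c}

/-- `A` is an antichain in the suborder `B` of `P`: two distinct members of `A` have no common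
lower bound in `B` (strong antichain, i.e. pairwise incompatible elements). -/
def IsAntichainIn {P : Type u} [PartialOrder P] (A B : Set P) : Prop :=
  A ⊆ B ∧ ∀ x ∈ A, ∀ y ∈ A, x ≠ y → ¬ ∃ z ∈ B, z ≤ x ∧ z ≤ y

/-- `[μ]^θ`: the subsets of `μ` (identified with the set of ordinals below its initial ordinal)
of cardinality `θ`. The lift is only a change of universe. -/
def subsetsOfCard (μ θ : Cardinal.{u}) : Set (Set Ordinal.{u}) :=
  {X | X ⊆ Iio μ.ord ∧ #X = lift.{u + 1} θ}

/-- The upper part of `[μ]^θ`: those `X` in `[μ]^θ` with `|X ∩ α| < θ` for all `α < μ`. -/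
def upperSubsets (μ θ : Cardinal.{u}) : Set (Set Ordinal.{u}) :=
  {X | X ∈ subsetsOfCard μ θ ∧ ∀ α < μ.ord, #(X ∩ Iio α : Set Ordinal.{u}) < lift.{u + 1} θ}

/-- The lower part of `[μ]^θ`: those `X` in `[μ]^θ` that are subsets of some `α < μ`. -/
def lowerSubsets (μ θ : Cardinal.{u}) : Set (Set Ordinal.{u}) :=
  {X | X ∈ subsetsOfCard μ θ ∧ ∃ α < μ.ord, X ⊆ Iio α}

/-- The lower `θ`-density of `μ`. -/
def lowerDensity (μ θ : Cardinal.{u}) : Cardinal.{u + 1} :=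
  density (lowerSubsets μ θ)

/-- `S^θ_κ`: the ordinals below `θ` of cofinality `κ`. -/
def cofSet (θ κ : Cardinal.{u}) : Set (Iio θ.ord) :=
  {i | (i : Ordinal.{u}).cof = κ}

/-- The family of all stationary subsets of `S^θ_κ` (stationary in `θ`). -/
def stationarySubsets (θ κ : Cardinal.{u}) : Set (Set (Iio θ.ord)) :=
  {S | S ⊆ cofSet θ κ ∧ IsStationary S}

/-- `c^{+γ}`: the `γ`-th cardinal successor of `c`; for `c = ℵ_ α` this is `ℵ_ (α + γ)`. -/
def succIter (c : Cardinal.{u}) (γ : Ordinal.{u}) : Cardinal.{u} :=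
  preAleph (preAleph.symm c + γ)

end DensityArithmetic

end

/-! Each member of `A` contains, for stationarily many `i`, a member of `D i`. If all `D i` have
size at most a fixed cardinal below `μ`, the graphs of the corresponding choice functions are sets
of size `θ` inside a single set of size less than `μ`, and any two of them have fewer than `θ`
common points, so members of a dense family of bounded sets separate them.

The general case is reduced to this one by induction on `γ`. Enumerate each `D i` in order type
at most `κ_i^{+γ}`. It suffices to find `μ^{+γ}` many functions with initial segments of smaller
size such that every member of the product of the `κ_i^{+γ}` lies below one of them on a
stationary set. For `γ = 0` these are constant functions, by Fodor's lemma. For limit `γ` they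
are the functions `i ↦ κ_i^{+β}` with `β < γ`. If there are no such functions at `γ + 1`, then
the product of the `κ_i^{+(γ+1)}` is `μ^{+(γ+1)}`-directed modulo the club filter, and club
guessing provides an increasing sequence of that length which is continuous enough. An upper
bound `h` of it has initial segments of size at most `κ_i^{+γ}` interleaving with the sequence.
The induction hypothesis shrinks them to sets of size at most a fixed `κ_j`, still interleaving
on a stationary set, and continuity makes this impossible. -/

namespace DensityArithmetic

open Filter

section Cofinality

variable {α : Type u} [LinearOrder α]

theorem exists_gt_of_mk_lt_cof {s : Set α} (hs : #s < Order.cof α) : ∃ y, ∀ x ∈ s, x < y :=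
  not_isCofinal_iff.1 fun h => (Order.cof_le h).not_gt hs

theorem exists_forall_lt_of_mk_lt_cof {ι : Type u} (f : ι → α) (hι : #ι < Order.cof α) :
    ∃ y, ∀ i, f i < y := by
  simpa using exists_gt_of_mk_lt_cof (mk_range_le.trans_lt hι : #(range f) < Order.cof α)

variable [WellFoundedLT α]

theorem exists_isLUB_of_bddAbove {s : Set α} (hs : BddAbove s) : ∃ x, IsLUB s x :=
  ⟨wellFounded_lt.min _ hs, wellFounded_lt.min_mem _ hs,
    fun _ hy => not_lt.1 (wellFounded_lt.not_lt_min _ hy)⟩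

theorem exists_forall_rel_of_step {β : Type*} (R : (z : α) → (Iio z → β) → β → Prop)
    (step : ∀ z prev, ∃ p, R z prev p) : ∃ f : α → β, ∀ z, R z (fun y => f y) (f z) := by
  choose next hnext using step
  let f : α → β := wellFounded_lt.fix fun z prev => next z fun y => prev y y.2
  have hf : ∀ z, f z = next z fun y => f y := fun z => wellFounded_lt.fix_eq _ z
  exact ⟨f, fun z => by rw [hf z]; exact hnext z _⟩

theorem exists_forall_ge_eq_of_antitone {U ι : Type u} [LinearOrder U] {f : ι → U → α}
    (hf : ∀ i, Antitone (f i)) (hι : #ι < Order.cof U) :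
    ∃ u, ∀ i, ∀ v ≥ u, f i v = f i u := by
  have hU : Nonempty U := Order.cof_ne_zero_iff.1 (zero_le.trans_lt hι).ne'
  have hmin (i : ι) : ∃ u, ∀ v, f i u ≤ f i v := by
    obtain ⟨_, ⟨u, rfl⟩, hu⟩ := wellFounded_lt.has_min (range (f i)) (range_nonempty _)
    exact ⟨u, fun v => not_lt.1 (hu _ ⟨v, rfl⟩)⟩
  choose m hm using hmin
  obtain ⟨u, hu⟩ := exists_forall_lt_of_mk_lt_cof m hι
  exact ⟨u, fun i v huv => le_antisymm (hf i huv) ((hf i (hu i).le).trans (hm i v))⟩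

theorem exists_strictMono_of_le_mk {τ : Cardinal.{u}} {s : Set α} (h : τ ≤ #s) :
    ∃ c : τ.ord.ToType → α, StrictMono c ∧ ∀ a, c a ∈ s := by
  have htype : typeLT τ.ord.ToType ≤ typeLT s := by
    rw [type_toType, ord_le, card_type]
    exact h
  obtain ⟨e⟩ := type_le_iff'.1 htype
  exact ⟨fun a => e a, fun a b hab => e.map_rel_iff.2 hab, fun a => (e a).2⟩

end Cofinality

section ClubSets

variable {α : Type u} [LinearOrder α]

theorem isClub_Ioi [NoMaxOrder α] (a : α) : IsClub (Ioi a) where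
  dirSupClosed := fun _ hs ⟨_, hx⟩ _ _ hb => (hs hx).trans_le (hb.1 hx)
  isCofinal b := by
    obtain ⟨c, hc⟩ := exists_gt (max a b)
    exact ⟨c, (le_max_left _ _).trans_lt hc, ((le_max_right _ _).trans_lt hc).le⟩

theorem isCofinal_of_isStationary [NoMaxOrder α] {S : Set α} (hS : IsStationary S) :
    IsCofinal S := fun a =>
  have ⟨b, hb, hab⟩ := hS (isClub_Ioi a)
  ⟨b, hb, hab.le⟩

end ClubSets

section RegularOrder

theorem mk_Iio_ord (c : Cardinal.{u}) : #(Iio c.ord) = lift.{u + 1} c := by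
  rw [Cardinal.mk_Iio_ordinal, card_ord]

theorem isRegularCardinalOrder_Iio_ord {c : Cardinal.{u}} (hc : c.IsRegular) :
    IsRegularCardinalOrder (Iio c.ord) where
  type_lt_le_ord_cof := by
    rw [Ordinal.cof_Iio, ← Ordinal.lift_cof, hc.cof_ord]
    simp

variable {α : Type u} [LinearOrder α] [WellFoundedLT α] [IsRegularCardinalOrder α]

theorem noMaxOrder_of_aleph0_le (h0 : ℵ₀ ≤ #α) : NoMaxOrder α where
  exists_gt a := by
    have h1 : #({a} : Set α) < Order.cof α := by
      rw [mk_singleton, Order.cof_eq_cardinalMk]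
      exact one_lt_aleph0.trans_le h0
    obtain ⟨b, hb⟩ := exists_gt_of_mk_lt_cof h1
    exact ⟨b, hb a rfl⟩

theorem mk_Iio_lt_cof (x : α) : #(Iio x) < Order.cof α := by
  rw [Order.cof_eq_cardinalMk]
  exact mk_Iio_lt x ord_cardinalMk

theorem cof_ne_aleph0_of_aleph0_lt (h0 : ℵ₀ < #α) : Order.cof α ≠ ℵ₀ := by
  rw [Order.cof_eq_cardinalMk]
  exact h0.ne'

theorem isClub_diagonalIntersection (h0 : ℵ₀ < #α) {C : α → Set α} (hC : ∀ j, IsClub (C j)) :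
    IsClub {d | ∀ j < d, d ∈ C j} := by
  have hmax := noMaxOrder_of_aleph0_le h0.le
  refine ⟨fun s hs _ _ d hd j hj => ?_, fun a => ?_⟩
  · obtain ⟨x, hx, hjx⟩ := (lt_isLUB_iff hd).1 hj
    have hsub : s ∩ Ici x ⊆ C j := fun y hy => hs hy.1 j (hjx.trans_le hy.2)
    exact (hC j).isLUB_mem hsub ⟨x, hx, le_rfl⟩ (hd.inter_Ici_of_mem hx)
  · have hnext (x : α) : ∃ y, x < y ∧ ∀ j ≤ x, y ∈ C j := by
      obtain ⟨x', hx'⟩ := exists_gt x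
      have hclub : IsClub (⋂ j : Iio x', C j) :=
        .iInter (cof_ne_aleph0_of_aleph0_lt h0) (Cardinal.lift_lt.2 (mk_Iio_lt_cof x'))
          fun j => hC j
      obtain ⟨y, hy, hxy⟩ := hclub.isCofinal x'
      exact ⟨y, hx'.trans_le hxy, fun j hj => mem_iInter.1 hy ⟨j, hj.trans_lt hx'⟩⟩
    choose n hn hnC using hnext
    let seq : ℕ → α := fun m => n^[m] a
    have hseq (m : ℕ) : seq (m + 1) = n (seq m) := Function.iterate_succ_apply' n m a
    have hmono : StrictMono seq := strictMono_nat_of_lt_succ fun m => hseq m ▸ hn _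
    obtain ⟨b, hb⟩ := exists_gt_of_mk_lt_cof (s := range seq) <|
      (countable_range _).le_aleph0.trans_lt (by rwa [Order.cof_eq_cardinalMk])
    obtain ⟨d, hd⟩ := exists_isLUB_of_bddAbove ⟨b, fun x hx => (hb x hx).le⟩
    refine ⟨d, fun j hj => ?_, hd.1 ⟨0, rfl⟩⟩
    obtain ⟨_, ⟨m, rfl⟩, hjm⟩ := (lt_isLUB_iff hd).1 hj
    have htail : range seq ∩ Ici (seq (m + 1)) ⊆ C j := by
      rintro _ ⟨⟨_ | m', rfl⟩, hm'⟩
      · exact absurd (hmono.le_iff_le.1 hm') (by lia)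
      · have hmm' : m ≤ m' := by simpa using hmono.le_iff_le.1 hm'
        exact hseq m' ▸ hnC _ j (hjm.le.trans (hmono.monotone hmm'))
    exact (hC j).isLUB_mem htail ⟨_, ⟨m + 1, rfl⟩, le_rfl⟩ (hd.inter_Ici_of_mem ⟨m + 1, rfl⟩)

theorem isClub_closurePoints (h0 : ℵ₀ < #α) (h : α → α) : IsClub {d | ∀ x < d, h x < d} :=
  have := noMaxOrder_of_aleph0_le h0.le
  isClub_diagonalIntersection h0 fun x => isClub_Ioi (h x)

end RegularOrder

section ClubFilter

variable {α : Type u} [LinearOrder α] {S D : Set α}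

/-- The club filter restricted to `S`: the filter generated by the sets `C ∩ S` with `C` club. It is
trivial if `S` is not stationary, and the sets which are positive for it are those whose trace on
`S` is stationary. -/
def clubFilterOn (S : Set α) : Filter α :=
  (⨅ C ∈ {C : Set α | IsClub C}, 𝓟 C) ⊓ 𝓟 S

theorem clubFilterOn_mono (h : S ⊆ D) : clubFilterOn S ≤ clubFilterOn D :=
  inf_le_inf_left _ (principal_mono.2 h)

theorem clubFilterOn_inf_principal : clubFilterOn S ⊓ 𝓟 D = clubFilterOn (S ∩ D) := by
  rw [clubFilterOn, inf_assoc, inf_principal, clubFilterOn]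

theorem mem_clubFilterOn_of_isClub {C : Set α} (hC : IsClub C) : C ∈ clubFilterOn S :=
  mem_inf_of_left (mem_iInf_of_mem C (mem_iInf_of_mem hC (mem_principal_self C)))

variable [WellFoundedLT α]

theorem frequently_clubFilterOn_iff (h0 : Order.cof α ≠ ℵ₀) {p : α → Prop} :
    (∃ᶠ i in clubFilterOn S, p i) ↔ IsStationary {i ∈ S | p i} := by
  have hdir : DirectedOn ((fun C : Set α => 𝓟 C) ⁻¹'o (· ≥ ·)) {C : Set α | IsClub C} :=
    fun C hC D hD => ⟨C ∩ D, hC.inter h0 hD, by simp, by simp⟩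
  rw [clubFilterOn, frequently_inf_principal, ← not_iff_not, not_frequently,
    not_isStationary_iff, Filter.Eventually, mem_biInf_of_directed hdir ⟨univ, .univ⟩]
  refine exists_congr fun C => and_congr_right fun _ => ?_
  rw [mem_principal, disjoint_comm, Set.disjoint_left]
  rfl

theorem clubFilterOn_neBot_iff (h0 : Order.cof α ≠ ℵ₀) :
    (clubFilterOn S).NeBot ↔ IsStationary S := by
  rw [← frequently_true_iff_neBot, frequently_clubFilterOn_iff h0]
  simp

variable [IsRegularCardinalOrder α]

theorem exists_frequently_eq_of_regressive (h0 : ℵ₀ < #α) {r : α → α}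
    (hr : ∃ᶠ i in clubFilterOn S, r i < i) : ∃ j, ∃ᶠ i in clubFilterOn S, r i = j := by
  simp only [frequently_clubFilterOn_iff (cof_ne_aleph0_of_aleph0_lt h0)] at hr ⊢
  by_contra! H
  simp only [not_isStationary_iff] at H
  choose C hC hdisj using H
  obtain ⟨i, ⟨hi, hri⟩, hiC⟩ := hr (isClub_diagonalIntersection h0 hC)
  exact Set.disjoint_left.1 (hdisj (r i)) ⟨hi, rfl⟩ (hiC _ hri)

theorem eventually_isSuccLimit (h0 : ℵ₀ < #α) (S : Set α) :
    ∀ᶠ i in clubFilterOn S, Order.IsSuccLimit i := by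
  have := noMaxOrder_of_aleph0_le h0.le
  have : Nonempty α := mk_ne_zero_iff.1 (pos_of_gt h0).ne'
  choose n hn using exists_gt (α := α)
  filter_upwards [mem_clubFilterOn_of_isClub (isClub_Ioi (Classical.arbitrary α)),
    mem_clubFilterOn_of_isClub (isClub_closurePoints h0 n)] with i hi hclosed
  exact ⟨not_isMin_iff.2 ⟨_, hi⟩, fun b hb => hb.2 (hn b) (hclosed b hb.1)⟩

end ClubFilter

section ClubGuessing

variable {Λ : Type u} [LinearOrder Λ] [WellFoundedLT Λ]

theorem exists_cof_Iio_eq {τ : Cardinal.{u}} (hτ : τ.IsRegular) (hΛ : τ < Order.cof Λ) {E : Set Λ}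
    (hE : IsCofinal E) :
    ∃ d : Λ, Order.cof (Iio d) = τ ∧ ∀ x < d, ∃ y ∈ E, x < y ∧ y < d := by
  obtain ⟨c, hc, hcE⟩ := exists_strictMono_of_le_mk (hΛ.le.trans (Order.cof_le hE))
  obtain ⟨b, hb⟩ := exists_forall_lt_of_mk_lt_cof c (by simpa)
  obtain ⟨d, hd⟩ := exists_isLUB_of_bddAbove (s := range c) ⟨b, by
    rintro _ ⟨t, rfl⟩
    exact (hb t).le⟩
  have := noMaxOrder hτ.aleph0_le
  have hcd (t) : c t < d := by
    obtain ⟨t', ht⟩ := exists_gt t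
    exact (hc ht).trans_le (hd.1 ⟨t', rfl⟩)
  have hcofinal (x) (hx : x < d) : ∃ t, x < c t := by
    obtain ⟨_, ⟨t, rfl⟩, ht⟩ := (lt_isLUB_iff hd).1 hx
    exact ⟨t, ht⟩
  refine ⟨d, ?_, fun x hx => ?_⟩
  · rw [← Order.cof_congr_of_strictMono (f := fun t => (⟨c t, hcd t⟩ : Iio d)) hc,
      Ordinal.cof_toType, hτ.cof_ord]
    rintro ⟨x, hx⟩
    obtain ⟨t, ht⟩ := hcofinal x hx
    exact ⟨_, ⟨t, rfl⟩, ht.le⟩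
  · obtain ⟨t, ht⟩ := hcofinal x hx
    exact ⟨c t, hcE t, ht, hcd t⟩

theorem exists_antitone_isClub {U : Type u} [LinearOrder U] [WellFoundedLT U]
    (hcof : Order.cof Λ ≠ ℵ₀) (hU : #U < Order.cof Λ) {N : Set Λ → Set Λ}
    (hN : ∀ E, IsClub (N E)) :
    ∃ E : U → Set Λ, Antitone E ∧ (∀ a, IsClub (E a)) ∧ ∀ a b, a < b → E b ⊆ N (E a) := by
  obtain ⟨E, hE⟩ := exists_forall_rel_of_step (α := U)
    (fun a prev (E : Set Λ) => E = ⋂ b : Iio a, N (prev b)) fun a prev => ⟨_, rfl⟩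
  refine ⟨E, fun a b hab => ?_, fun a => ?_, fun a b hab => ?_⟩
  · rw [hE a, hE b]
    exact subset_iInter fun c =>
      iInter_subset (fun c : Iio b => N (E c)) ⟨c, c.2.trans_le hab⟩
  · rw [hE a]
    exact .iInter hcof (Cardinal.lift_lt.2 ((mk_set_le _).trans_lt hU)) fun b => hN _
  · rw [hE b]
    exact iInter_subset (fun c : Iio b => N (E c)) ⟨a, hab⟩

section Glue

variable [Nonempty Λ]

attribute [local instance] WellFoundedLT.toOrderBot
  WellFoundedLT.conditionallyCompleteLinearOrderBot

/-- The largest element of the closed set `E` that is at most `b`. It is `⊥` if there is none. -/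
noncomputable def floorIn (E : Set Λ) (b : Λ) : Λ :=
  sSup (E ∩ Iic b)

/-- The set `A` glued to `E`: every element is moved down to `E`, and the junk value `⊥` is
discarded. -/
noncomputable def glue (E A : Set Λ) : Set Λ :=
  floorIn E '' A \ {⊥}

theorem floorIn_le {E : Set Λ} {b : Λ} : floorIn E b ≤ b :=
  csSup_le' fun _ hx => hx.2

theorem le_floorIn {E : Set Λ} {x b : Λ} (hx : x ∈ E) (hxb : x ≤ b) : x ≤ floorIn E b :=
  le_csSup ⟨b, fun _ hy => hy.2⟩ ⟨hx, hxb⟩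

theorem floorIn_mono {E E' : Set Λ} (h : E ⊆ E') (b : Λ) : floorIn E b ≤ floorIn E' b :=
  csSup_le' fun _ hx => le_floorIn (h hx.1) hx.2

theorem floorIn_mem {E : Set Λ} (hE : DirSupClosed E) {b : Λ} (h : floorIn E b ≠ ⊥) :
    floorIn E b ∈ E := by
  have hne : (E ∩ Iic b).Nonempty := by
    by_contra! hempty
    exact h (by rw [floorIn, hempty, csSup_empty])
  exact hE inter_subset_left hne (.of_linearOrder _) (isLUB_csSup hne ⟨b, fun _ hy => hy.2⟩)

theorem glue_subset_of_floorIn_eq {E E' A : Set Λ} (hE' : DirSupClosed E')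
    (h : ∀ b ∈ A, floorIn E' b = floorIn E b) : glue E A ⊆ E' := by
  rintro _ ⟨⟨b, hb, rfl⟩, hne⟩
  rw [← h b hb] at hne ⊢
  exact floorIn_mem hE' hne

theorem mk_glue_eq_cof {d : Λ} {A : Set (Iio d)} (hA : IsCofinal A)
    (hmk : #A = Order.cof (Iio d)) {E : Set Λ} (hE : ∀ x < d, ∃ y ∈ E, x < y ∧ y < d) :
    #(glue E ((↑) '' A)) = Order.cof (Iio d) := by
  refine le_antisymm ((mk_le_mk_of_subset sdiff_subset).trans
    (mk_image_le.trans (mk_image_le.trans hmk.le))) ?_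
  have hcofinal : IsCofinal {x : Iio d | (x : Λ) ∈ glue E ((↑) '' A)} := by
    rintro ⟨x, hx⟩
    obtain ⟨y, hyE, hxy, hyd⟩ := hE x hx
    obtain ⟨b, hb, hyb⟩ := hA ⟨y, hyd⟩
    have hxf : x < floorIn E b := hxy.trans_le (le_floorIn hyE hyb)
    exact ⟨⟨floorIn E b, floorIn_le.trans_lt b.2⟩, ⟨⟨b, ⟨b, hb, rfl⟩, rfl⟩,
      (bot_le.trans_lt hxf).ne'⟩, hxf.le⟩
  refine (Order.cof_le hcofinal).trans ?_
  exact mk_preimage_of_injective _ _ Subtype.val_injective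

end Glue

theorem exists_club_guessing {τ : Cardinal.{u}} (hτ : τ.IsRegular)
    (hΛ : Order.succ τ < Order.cof Λ) :
    ∃ 𝒞 : Set (Set Λ), #𝒞 ≤ #Λ ∧ (∀ C ∈ 𝒞, #C = τ) ∧ ∀ E, IsClub E → ∃ C ∈ 𝒞, C ⊆ E := by
  have hτΛ : τ < Order.cof Λ := (Order.lt_succ τ).trans hΛ
  have hcof : Order.cof Λ ≠ ℵ₀ := (hτ.aleph0_le.trans_lt hτΛ).ne'
  have : Nonempty Λ := Order.cof_ne_zero_iff.1 (zero_le.trans_lt hΛ).ne'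
  choose A hA hAmk using fun d : Λ => Order.exists_cof_eq (Iio d)
  let guess (E : Set Λ) : Set (Set Λ) := {C ∈ range fun d => glue E ((↑) '' A d) | #C = τ}
  -- If no `guess E` works, a club avoiding the members of `guess E` can be chosen for every `E`.
  by_contra! H
  choose N hN hNsub using fun E => H (guess E)
    ((mk_le_mk_of_subset (sep_subset _ _)).trans mk_range_le) fun C hC => hC.2
  let U := (Order.succ τ).ord.ToType
  have hUcof : Order.cof U = Order.succ τ := by
    rw [Ordinal.cof_toType, (isRegular_succ hτ.aleph0_le).cof_ord]
  obtain ⟨E, hEanti, hEclub, hEN⟩ := exists_antitone_isClub (U := U) hcof (by simpa [U]) hN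
  have hEinter : IsClub (⋂ a, E a) := .iInter hcof (by simpa [U]) hEclub
  obtain ⟨d, hd, hdE⟩ := exists_cof_Iio_eq hτ hτΛ hEinter.isCofinal
  obtain ⟨a, ha⟩ := exists_forall_ge_eq_of_antitone (U := U)
    (f := fun (b : A d) a => floorIn (E a) b) (fun b a a' h => floorIn_mono (hEanti h) b) (by
      rw [hAmk, hd, hUcof]
      exact Order.lt_succ τ)
  have : NoMaxOrder U := noMaxOrder (hτ.aleph0_le.trans (Order.le_succ τ))
  obtain ⟨a', haa'⟩ := exists_gt a
  have hsub : glue (E a) ((↑) '' A d) ⊆ E a' := by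
    refine glue_subset_of_floorIn_eq (hEclub a').dirSupClosed ?_
    rintro _ ⟨b, hb, rfl⟩
    exact ha ⟨b, hb⟩ a' haa'.le
  refine hNsub (E a) _ ⟨⟨d, rfl⟩, ?_⟩ (hsub.trans (hEN a a' haa'))
  rw [mk_glue_eq_cof (hA d) (hAmk d) fun x hx => ?_, hd]
  obtain ⟨y, hy, hxy⟩ := hdE x hx
  exact ⟨y, mem_iInter.1 hy a, hxy⟩

end ClubGuessing

section Interleaving

variable {Θ Λ β : Type u} {F F' : Filter Θ} {f : Λ → Θ → β}
  {W : Θ → Set β} {τ : Cardinal.{u}}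

/-- `W i` has an element in the interval `[f z i, f z' i)`. -/
def Meets [Preorder β] (W : Θ → Set β) (f : Λ → Θ → β) (z z' : Λ) (i : Θ) : Prop :=
  (W i ∩ Ico (f z i) (f z' i)).Nonempty

/-- The sets `W i` interleave with the sequence `f` modulo `F`. -/
def Covers [Preorder β] (F : Filter Θ) (W : Θ → Set β) (f : Λ → Θ → β) : Prop :=
  ∀ z, ∃ z', ∀ᶠ i in F, Meets W f z z' i

theorem Meets.mono [Preorder β] {z₁ z₂ z₁' z₂' : Λ} {i : Θ} (h : Meets W f z₁ z₁' i)
    (hz : f z₂ i ≤ f z₁ i) (hz' : f z₁' i ≤ f z₂' i) : Meets W f z₂ z₂' i :=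
  Set.Nonempty.mono (inter_subset_inter_right _ (Ico_subset_Ico hz hz')) h

variable [LinearOrder Λ]

/-- The sequence `f` is strictly increasing modulo the filter `F`. -/
def IncreasingMod [LT β] (F : Filter Θ) (f : Λ → Θ → β) : Prop :=
  ∀ ⦃z z'⦄, z < z' → ∀ᶠ i in F, f z i < f z' i

/-- Every club of indices contains a set of `τ` indices whose initial segments are bounded by `f`
uniformly modulo `F`: for most `i`, the value `f z i` bounds all values `f y i` with `y < z` in the
set. -/
def IsClubContinuous [LE β] (F : Filter Θ) (f : Λ → Θ → β) (τ : Cardinal.{u}) : Prop :=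
  ∀ E : Set Λ, IsClub E → ∃ C ⊆ E, #C = τ ∧ ∀ z, ∀ᶠ i in F, ∀ y ∈ C, y < z → f y i ≤ f z i

theorem IncreasingMod.mono [LT β] (hf : IncreasingMod F f) (hF : F' ≤ F) : IncreasingMod F' f :=
  fun _ _ h => (hf h).filter_mono hF

theorem IncreasingMod.eventually_le [Preorder β] (hf : IncreasingMod F f) {z z' : Λ}
    (h : z ≤ z') : ∀ᶠ i in F, f z i ≤ f z' i := by
  obtain rfl | h := h.eq_or_lt
  · exact .of_forall fun i => le_rfl
  · exact (hf h).mono fun i hi => hi.le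

theorem IsClubContinuous.mono [LE β] (hc : IsClubContinuous F f τ) (hF : F' ≤ F) :
    IsClubContinuous F' f τ := fun E hE => by
  obtain ⟨C, hCE, hC, hCf⟩ := hc E hE
  exact ⟨C, hCE, hC, fun z => (hCf z).filter_mono hF⟩

variable [WellFoundedLT Λ] [IsRegularCardinalOrder Λ]

/-- Along a guessed set of closure points of `n`, each pair of consecutive indices `z, z'` has a
coordinate at which `P d z z'` holds and the values of `f` are in order. As there are fewer than `τ`
coordinates, `τ` many of these pairs share one. -/
theorem exists_interleaved_chain [Preorder β] (hc : IsClubContinuous F f τ) (hτ : τ.IsRegular)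
    (hΘ : #Θ < τ) (hΛ : τ < #Λ) {P : Λ → Λ → Λ → Θ → Prop} (n : Λ → Λ)
    (hP : ∀ d z z', n z < z' → ∃ᶠ i in F, P d z z' i) :
    ∃ (i : Θ) (d : Λ) (z z' : τ.ord.ToType → Λ), (∀ a, P d (z a) (z' a) i) ∧
      (∀ a, f (z' a) i ≤ f d i) ∧ ∀ a b, a < b → f (z' a) i ≤ f (z b) i := by
  obtain ⟨C, hCn, hC, hCf⟩ := hc _ (isClub_closurePoints (hτ.aleph0_le.trans_lt hΛ) n)
  obtain ⟨c, hc, hcC⟩ := exists_strictMono_of_le_mk hC.ge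
  obtain ⟨d, hd⟩ := exists_gt_of_mk_lt_cof (s := C) (by rwa [hC, Order.cof_eq_cardinalMk])
  have := noMaxOrder hτ.aleph0_le
  let _ : SuccOrder τ.ord.ToType := .ofLinearWellFoundedLT _
  have hcoord (a) : ∃ i, P d (c a) (c (Order.succ a)) i ∧ (∀ y ∈ C, y < c a → f y i ≤ f (c a) i) ∧
      ∀ y ∈ C, f y i ≤ f d i := by
    have hn : n (c a) < c (Order.succ a) := hCn (hcC _) _ (hc (Order.lt_succ a))
    obtain ⟨i, hi, hia, hid⟩ := ((hP d _ _ hn).and_eventually ((hCf (c a)).and (hCf d))).exists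
    exact ⟨i, hi, hia, fun y hy => hid y hy (hd y hy)⟩
  choose ix hP hlt hle using hcoord
  obtain ⟨i, hi⟩ := infinite_pigeonhole_card ix τ (by simp) hτ.aleph0_le (by rwa [hτ.cof_ord])
  obtain ⟨e, he, hei⟩ := exists_strictMono_of_le_mk hi
  replace hei (a) : ix (e a) = i := hei a
  refine ⟨i, d, fun a => c (e a), fun a => c (Order.succ (e a)), fun a => hei a ▸ hP (e a),
    fun a => hei a ▸ hle (e a) _ (hcC _), fun a b hab => ?_⟩
  obtain h | h := (Order.succ_le_of_lt (he hab)).eq_or_lt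
  · exact (congrArg (fun t => f (c t) i) h).le
  · exact hei b ▸ hlt (e b) _ (hcC _) (hc h)

theorem exists_interleaved_pair [Preorder β] (hc : IsClubContinuous F f τ) (hτ : τ.IsRegular)
    (hΘ : #Θ < τ) (hΛ : τ < #Λ) {P : Λ → Λ → Λ → Θ → Prop} (n : Λ → Λ)
    (hP : ∀ d z z', n z < z' → ∃ᶠ i in F, P d z z' i) :
    ∃ i d z₁ z₁' z₂ z₂', P d z₁ z₁' i ∧ P d z₂ z₂' i ∧ f z₁' i ≤ f z₂ i ∧ f z₂' i ≤ f d i := by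
  obtain ⟨i, d, z, z', hPi, hle, hlt⟩ := exists_interleaved_chain hc hτ hΘ hΛ n hP
  have := noMaxOrder hτ.aleph0_le
  have : Nonempty τ.ord.ToType := mk_ne_zero_iff.1 (by simpa using hτ.pos.ne')
  obtain ⟨a⟩ := this
  obtain ⟨b, hab⟩ := exists_gt a
  exact ⟨i, d, z a, z' a, z b, z' b, hPi a, hPi b, hlt a b hab, hle b⟩

variable [LinearOrder β]

theorem exists_forall_eventually_lt_of_lt (hf : IncreasingMod F f) (hc : IsClubContinuous F f τ)
    (hτ : τ.IsRegular) (hΘ : #Θ < τ) (hΛ : τ < #Λ) (g : Θ → β) :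
    ∃ m, ∀ z, ∀ᶠ i in F, g i < f z i → g i < f m i := by
  by_contra! H
  choose n hn using H
  have hP (z z' : Λ) (h : n z < z') : ∃ᶠ i in F, f z i ≤ g i ∧ g i < f z' i := by
    have hfreq : ∃ᶠ i in F, g i < f (n z) i ∧ f z i ≤ g i := by
      simpa [not_eventually] using hn z
    exact (hfreq.and_eventually (hf h)).mono fun i hi => ⟨hi.1.2, hi.1.1.trans hi.2⟩
  obtain ⟨i, d, z₁, z₁', z₂, z₂', h₁, h₂, h, -⟩ :=
    exists_interleaved_pair hc hτ hΘ hΛ n fun _ => hP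
  exact ((h₁.2.trans_le h).trans_le h₂.1).false

theorem not_covers_of_mk_lt [F.NeBot] (hf : IncreasingMod F f) (hc : IsClubContinuous F f τ)
    (hτ : τ.IsRegular) (hΘ : #Θ < τ) (hΛ : τ < #Λ) (hW : ∀ i, #(W i) < τ) :
    ¬ Covers F W f := by
  intro hcov
  choose n hn using hcov
  obtain ⟨i, d, z, z', hmeets, -, hlt⟩ := exists_interleaved_chain (P := fun _ => Meets W f)
    hc hτ hΘ hΛ n fun _ z z' h =>
      ((hn z).and (hf h)).frequently.mono fun i hi => hi.1.mono le_rfl hi.2.le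
  choose w hw using hmeets
  have hmono : StrictMono w := fun a b hab =>
    (hw a).2.2.trans_le ((hlt a b hab).trans (hw b).2.1)
  have hle : τ ≤ #(W i) := by
    have := mk_le_of_injective (f := fun a => (⟨w a, (hw a).1⟩ : W i)) fun a b hab =>
      hmono.injective (congrArg Subtype.val hab)
    simpa using this
  exact (hle.trans_lt (hW i)).false

theorem exists_forall_eventually_meets_of_meets (hf : IncreasingMod F f)
    (hc : IsClubContinuous F f τ) (hτ : τ.IsRegular) (hΘ : #Θ < τ) (hΛ : τ < #Λ) {m : Λ → Λ}
    (hm : ∀ z z', ∀ᶠ i in F, Meets W f z z' i → Meets W f z (m z) i) :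
    ∃ z, ∀ z', ∀ᶠ i in F, Meets W f z (m z) i → Meets W f z' (m z') i := by
  by_contra! H
  choose n hn using H
  have hP (d z z' : Λ) (h : max (n z) (m z) < z') :
      ∃ᶠ i in F, Meets W f z z' i ∧ ¬ Meets W f z' d i := by
    obtain ⟨hnz', hmz'⟩ := max_lt_iff.1 h
    have hfreq : ∃ᶠ i in F, Meets W f z (m z) i ∧ ¬ Meets W f (n z) (m (n z)) i := by
      simpa [not_eventually] using hn z
    refine (hfreq.and_eventually ((hf hnz').and ((hf hmz').and (hm (n z) d)))).mono ?_
    rintro i ⟨⟨hmeets, hnot⟩, hni, hmi, hd⟩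
    exact ⟨hmeets.mono le_rfl hmi.le, fun h => hnot (hd (h.mono hni.le le_rfl))⟩
  obtain ⟨i, d, z₁, z₁', z₂, z₂', h₁, h₂, hz, hd⟩ := exists_interleaved_pair hc hτ hΘ hΛ _ hP
  exact h₁.2 (h₂.1.mono hz hd)

variable [WellFoundedLT β]

theorem exists_forall_eventually_meets (hf : IncreasingMod F f) (hc : IsClubContinuous F f τ)
    (hτ : τ.IsRegular) (hΘ : #Θ < τ) (hΛ : τ < #Λ) (W : Θ → Set β) (z : Λ) :
    ∃ m, ∀ z', ∀ᶠ i in F, Meets W f z z' i → Meets W f z m i := by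
  classical
  have hleast (i : Θ) : ∃ g, (W i ∩ Ici (f z i)).Nonempty → IsLeast (W i ∩ Ici (f z i)) g := by
    by_cases h : (W i ∩ Ici (f z i)).Nonempty
    · exact ⟨wellFounded_lt.min _ h, fun _ => ⟨wellFounded_lt.min_mem _ h,
        fun _ hy => not_lt.1 (wellFounded_lt.not_lt_min _ hy)⟩⟩
    · exact ⟨f z i, fun h' => absurd h' h⟩
  choose g hg using hleast
  obtain ⟨m, hm⟩ := exists_forall_eventually_lt_of_lt hf hc hτ hΘ hΛ g
  refine ⟨m, fun z' => (hm z').mono ?_⟩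
  rintro i hi ⟨w, hw, hzw, hwz'⟩
  obtain ⟨hgmem, hgle⟩ := hg i ⟨w, hw, hzw⟩
  exact ⟨g i, hgmem.1, hgmem.2, hi ((hgle ⟨hw, hzw⟩).trans_lt hwz')⟩

theorem exists_covers_of_frequently_meets (hf : IncreasingMod F f) (hc : IsClubContinuous F f τ)
    (hτ : τ.IsRegular) (hΘ : #Θ < τ) (hΛ : τ < #Λ)
    (hW : ∀ z, ∃ z', ∃ᶠ i in F, Meets W f z z' i) :
    ∃ D : Set Θ, (∃ᶠ i in F, i ∈ D) ∧ Covers (F ⊓ 𝓟 D) W f := by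
  choose m hm using exists_forall_eventually_meets hf hc hτ hΘ hΛ W
  obtain ⟨z₀, hz₀⟩ := exists_forall_eventually_meets_of_meets hf hc hτ hΘ hΛ hm
  obtain ⟨z₁, hz₁⟩ := hW z₀
  refine ⟨{i | Meets W f z₀ (m z₀) i}, hz₁.mp (hm z₀ z₁), fun z => ⟨m z, ?_⟩⟩
  exact eventually_inf_principal.2 (hz₀ z)

theorem Covers.exists_covers_piece [F.NeBot] (hf : IncreasingMod F f) (hc : IsClubContinuous F f τ)
    (hτ : τ.IsRegular) (hΘ : #Θ < τ) (hΛ : τ < #Λ) (hcov : Covers F W f) {J : Type u}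
    (hJ : #J < #Λ) (V : J → Θ → Set β)
    (hV : ∀ w : Θ → β, (∀ᶠ i in F, w i ∈ W i) → ∃ j, ∃ᶠ i in F, w i ∈ V j i) :
    ∃ (j : J) (D : Set Θ), (∃ᶠ i in F, i ∈ D) ∧ Covers (F ⊓ 𝓟 D) (V j) f := by
  choose n hn using hcov
  have hpiece (z : Λ) : ∃ j, ∃ᶠ i in F, Meets (V j) f z (n z) i := by
    obtain ⟨w, hw⟩ := (hn z).choice
    obtain ⟨j, hj⟩ := hV w (hw.mono fun i hi => hi.1)
    exact ⟨j, (hj.and_eventually hw).mono fun i hi => ⟨w i, hi.1, hi.2.2⟩⟩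
  choose jz hjz using hpiece
  obtain ⟨j, hj⟩ : ∃ j, ∀ z, ∃ z' ≥ z, jz z' = j := by
    by_contra! H
    choose b hb using H
    obtain ⟨y, hy⟩ := exists_forall_lt_of_mk_lt_cof b (by rwa [Order.cof_eq_cardinalMk])
    exact hb (jz y) y (hy _).le rfl
  refine ⟨j, exists_covers_of_frequently_meets hf hc hτ hΘ hΛ fun z => ?_⟩
  obtain ⟨z', hz', rfl⟩ := hj z
  exact ⟨n z', ((hjz z').and_eventually (hf.eventually_le hz')).mono
    fun i hi => hi.1.mono hi.2 le_rfl⟩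

end Interleaving

section Directedness

variable {Θ Λ : Type (u + 1)} {F : Filter Θ} {l : Θ → Ordinal.{u}} {L : Cardinal.{u + 1}}

/-- The product of the ordinals `l i`, ordered by strict inequality modulo `F`, is `L⁺`-directed:
any family of at most `L` members has a common upper bound. -/
def IsDirectedMod (F : Filter Θ) (l : Θ → Ordinal.{u}) (L : Cardinal.{u + 1}) : Prop :=
  ∀ (ι : Type (u + 1)) (g : ι → Θ → Ordinal.{u}), #ι ≤ L → (∀ j i, g j i < l i) →
    ∃ p : Θ → Ordinal.{u}, (∀ i, p i < l i) ∧ ∀ j, ∀ᶠ i in F, g j i < p i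

theorem IsDirectedMod.exists_bound (h : IsDirectedMod F l L) (hL : ℵ₀ ≤ L)
    {ι Q : Type (u + 1)} (hι : #ι ≤ L) (hQ : #Q ≤ L) {g : ι → Θ → Ordinal.{u}}
    (hg : ∀ j i, g j i < l i) {C : Q → Set ι}
    (hC : ∀ q, ∀ᶠ i in F, #(C q) < lift.{u + 1} (l i).cof) :
    ∃ p : Θ → Ordinal.{u}, (∀ i, p i < l i) ∧ (∀ j, ∀ᶠ i in F, g j i < p i) ∧
      ∀ q, ∀ᶠ i in F, ∀ j ∈ C q, g j i ≤ p i := by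
  classical
  obtain ⟨p₀, hp₀, -⟩ := h ι g hι hg
  let s (q : Q) (i : Θ) : Ordinal.{u} := ⨆ j : C q, g j i
  let s' (q : Q) (i : Θ) : Ordinal.{u} := if s q i < l i then s q i else p₀ i
  have hs' (q i) : s' q i < l i := by
    simp only [s']
    split_ifs with hsi
    exacts [hsi, hp₀ i]
  obtain ⟨p, hp, hpb⟩ := h (ι ⊕ Q) (Sum.elim g s')
    (by rw [mk_sum, Cardinal.lift_id, Cardinal.lift_id]; exact add_le_of_le hL hι hQ)
    (Sum.rec hg hs')
  refine ⟨p, hp, fun j => hpb (.inl j), fun q => ?_⟩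
  filter_upwards [hC q, hpb (.inr q)] with i hi hlt j hj
  have hs : s q i < l i := by
    refine Ordinal.lift_iSup_lt_of_lt_cof ?_ fun j => hg j i
    rwa [← Ordinal.lift_cof, Cardinal.lift_id'.{u, u + 1}]
  simp only [Sum.elim_inr, s', if_pos hs] at hlt
  exact (le_ciSup (f := fun j : C q => g j i)
    ⟨l i, forall_mem_range.2 fun j => (hg j i).le⟩ ⟨j, hj⟩).trans hlt.le

theorem IsDirectedMod.exists_increasingMod_isClubContinuous [LinearOrder Λ] [WellFoundedLT Λ]
    (h : IsDirectedMod F l #Λ) {Q : Type (u + 1)} (hQ : #Q ≤ #Λ) {τ : Q → Cardinal.{u + 1}}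
    (hτ : ∀ q, (τ q).IsRegular) (hτΛ : ∀ q, Order.succ (τ q) < Order.cof Λ) (hΛ : ℵ₀ ≤ #Λ)
    (hτl : ∀ q, ∀ᶠ i in F, τ q < lift.{u + 1} (l i).cof) :
    ∃ f : Λ → Θ → Ordinal.{u}, (∀ z i, f z i < l i) ∧ IncreasingMod F f ∧
      ∀ q, IsClubContinuous F f (τ q) := by
  choose 𝒞 h𝒞 h𝒞τ hguess using fun q => exists_club_guessing (hτ q) (hτΛ q)
  have hindex : #(Σ q, 𝒞 q) ≤ #Λ := by
    rw [mk_sigma]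
    refine (sum_le_sum _ _ h𝒞).trans ?_
    rw [sum_const, Cardinal.lift_id, Cardinal.lift_id]
    exact mul_le_of_le hΛ hQ le_rfl
  let P := {p : Θ → Ordinal.{u} // ∀ i, p i < l i}
  obtain ⟨f, hf⟩ := exists_forall_rel_of_step (α := Λ) (β := P)
    (fun z prev p => (∀ y, ∀ᶠ i in F, (prev y).1 i < p.1 i) ∧
      ∀ q : Σ q, 𝒞 q, ∀ᶠ i in F, ∀ y : Iio z, (y : Λ) ∈ (q.2 : Set Λ) → (prev y).1 i ≤ p.1 i)
    fun z prev => by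
      obtain ⟨p, hp, hlt, hle⟩ := h.exists_bound hΛ (mk_set_le (Iio z)) hindex
        (g := fun y => (prev y).1) (fun y => (prev y).2)
        (C := fun q => {y | (y : Λ) ∈ (q.2 : Set Λ)}) fun q => (hτl q.1).mono fun i hi =>
          ((mk_preimage_of_injective _ _ Subtype.val_injective).trans
            (h𝒞τ q.1 _ q.2.2).le).trans_lt hi
      exact ⟨⟨p, hp⟩, hlt, hle⟩
  refine ⟨fun z => (f z).1, fun z => (f z).2, fun z z' hzz' => (hf z').1 ⟨z, hzz'⟩,
    fun q E hE => ?_⟩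
  obtain ⟨C, hC, hCE⟩ := hguess q E hE
  exact ⟨C, hCE, h𝒞τ q C hC, fun z => ((hf z).2 ⟨q, C, hC⟩).mono
    fun i hi y hy hyz => hi ⟨y, hyz⟩ hy⟩

end Directedness

section SuccIter

variable {c d : Cardinal.{u}} {a b : Ordinal.{u}}

@[simp]
theorem succIter_zero (c : Cardinal.{u}) : succIter c 0 = c := by
  simp [succIter]

theorem succIter_add_one (c : Cardinal.{u}) (a : Ordinal.{u}) :
    succIter c (a + 1) = Order.succ (succIter c a) := by
  simp [succIter, ← add_assoc]

theorem succIter_lt_succIter (h : a < b) : succIter c a < succIter c b := by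
  simpa [succIter] using h

theorem succIter_mono_right (h : a ≤ b) : succIter c a ≤ succIter c b := by
  simpa [succIter] using h

theorem le_succIter (c : Cardinal.{u}) (a : Ordinal.{u}) : c ≤ succIter c a := by
  simpa using succIter_mono_right (c := c) (zero_le (a := a))

theorem isRegular_succIter_add_one (hc : ℵ₀ ≤ c) (a : Ordinal.{u}) :
    (succIter c (a + 1)).IsRegular := by
  rw [succIter_add_one]
  exact isRegular_succ (hc.trans (le_succIter c a))

theorem exists_lt_succIter_of_isSuccLimit (ha : Order.IsSuccLimit a) (h : d < succIter c a) :
    ∃ b < a, d < succIter c b :=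
  ((isNormal_preAleph.comp (isNormal_add_right _)).lt_iff_exists_lt ha).1 h

end SuccIter

section Enumeration

variable {c : Cardinal.{u}}

theorem exists_injOn_mapsTo_Iio_ord {α : Type (u + 1)} {X : Set α} (h : #X ≤ lift.{u + 1} c) :
    ∃ e : α → Ordinal.{u}, InjOn e X ∧ MapsTo e X (Iio c.ord) := by
  rw [← mk_Iio_ord] at h
  obtain ⟨e⟩ := h
  classical
  refine ⟨fun x => if h : x ∈ X then e ⟨x, h⟩ else 0, fun x hx y hy hxy => ?_, fun x hx => ?_⟩
  · simp only [dif_pos hx, dif_pos hy] at hxy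
    exact congrArg Subtype.val (e.injective (Subtype.ext hxy))
  · simp only [dif_pos hx]
    exact (e ⟨x, hx⟩).2

theorem mk_Iic_le_lift {o : Ordinal.{u}} (ho : o.card ≤ c) (hc : ℵ₀ ≤ c) :
    #(Iic o) ≤ lift.{u + 1} c := by
  rw [← Order.Iio_succ, Order.succ_eq_add_one, Cardinal.mk_Iio_ordinal, Cardinal.lift_le,
    card_add_one]
  exact add_le_of_le hc ho (one_le_aleph0.trans hc)

end Enumeration

section Domination

variable {θ μ : Cardinal.{u}} {k : Iio θ.ord → Cardinal.{u}} {a b : Ordinal.{u}}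
  {α : Type (u + 1)} {S : Set (Iio θ.ord)}

/-- `k` is a strictly increasing continuous sequence of cardinals above `θ` with limit `μ`, indexed
by the regular uncountable cardinal `θ`. -/
structure IsNormalApprox (k : Iio θ.ord → Cardinal.{u}) (μ : Cardinal.{u}) : Prop where
  isRegular : θ.IsRegular
  aleph0_lt : ℵ₀ < θ
  isNormal : Order.IsNormal k
  isLUB : IsLUB (range k) μ
  lt_apply : ∀ i, θ < k i

namespace IsNormalApprox

theorem isRegularCardinalOrder (hk : IsNormalApprox k μ) : IsRegularCardinalOrder (Iio θ.ord) :=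
  isRegularCardinalOrder_Iio_ord hk.isRegular

theorem aleph0_lt_mk_index (hk : IsNormalApprox k μ) : ℵ₀ < #(Iio θ.ord) := by
  rw [mk_Iio_ord]
  simpa using hk.aleph0_lt

theorem noMaxOrder_index (hk : IsNormalApprox k μ) : NoMaxOrder (Iio θ.ord) :=
  have := hk.isRegularCardinalOrder
  noMaxOrder_of_aleph0_le hk.aleph0_lt_mk_index.le

theorem cof_index_ne_aleph0 (hk : IsNormalApprox k μ) : Order.cof (Iio θ.ord) ≠ ℵ₀ :=
  have := hk.isRegularCardinalOrder
  cof_ne_aleph0_of_aleph0_lt hk.aleph0_lt_mk_index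

theorem nonempty_index (hk : IsNormalApprox k μ) : Nonempty (Iio θ.ord) :=
  ⟨⟨0, hk.isRegular.ord_pos⟩⟩

theorem aleph0_le_apply (hk : IsNormalApprox k μ) (i : Iio θ.ord) : ℵ₀ ≤ k i :=
  (hk.aleph0_lt.trans (hk.lt_apply i)).le

theorem apply_lt (hk : IsNormalApprox k μ) (i : Iio θ.ord) : k i < μ := by
  have := hk.noMaxOrder_index
  obtain ⟨j, hij⟩ := exists_gt i
  exact (hk.isNormal.strictMono hij).trans_le (hk.isLUB.1 ⟨j, rfl⟩)

theorem lt_limit (hk : IsNormalApprox k μ) : θ < μ :=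
  have ⟨i⟩ := hk.nonempty_index
  (hk.lt_apply i).trans (hk.apply_lt i)

theorem aleph0_le_limit (hk : IsNormalApprox k μ) : ℵ₀ ≤ μ :=
  (hk.aleph0_lt.trans hk.lt_limit).le

theorem aleph0_le_lift_succIter (hk : IsNormalApprox k μ) (a : Ordinal.{u}) :
    ℵ₀ ≤ lift.{u + 1} (succIter μ a) :=
  aleph0_le_lift.2 (hk.aleph0_le_limit.trans (le_succIter μ a))

theorem exists_lt_apply (hk : IsNormalApprox k μ) {c : Cardinal.{u}} (hc : c < μ) :
    ∃ i, c < k i := by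
  obtain ⟨_, ⟨i, rfl⟩, hi⟩ := (lt_isLUB_iff hk.isLUB).1 hc
  exact ⟨i, hi⟩

theorem succ_lt (hk : IsNormalApprox k μ) {c : Cardinal.{u}} (hc : c < μ) : Order.succ c < μ := by
  obtain ⟨i, hi⟩ := hk.exists_lt_apply hc
  exact (Order.succ_le_of_lt hi).trans_lt (hk.apply_lt i)

end IsNormalApprox

/-- The sets `V i` are uniformly smaller than `κ_i^{+a}`: either of size at most `κ_i^{+b}` for a
fixed `b < a`, or of size at most a fixed `κ_j`. -/
def IsSmallBelow (k : Iio θ.ord → Cardinal.{u}) (a : Ordinal.{u}) (V : Iio θ.ord → Set α) : Prop :=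
  (∃ b < a, ∀ i, #(V i) ≤ lift.{u + 1} (succIter (k i) b)) ∨ ∃ j, ∀ i, #(V i) ≤ lift.{u + 1} (k j)

/-- At most `μ^{+a}` many functions with small initial segments dominate, each time on a stationary
subset of `S`, all members of the product of the `κ_i^{+a}`. -/
def HasSmallDomination (k : Iio θ.ord → Cardinal.{u}) (μ : Cardinal.{u}) (a : Ordinal.{u})
    (S : Set (Iio θ.ord)) : Prop :=
  ∃ (J : Type (u + 1)) (g : J → Iio θ.ord → Ordinal.{u}), #J ≤ lift.{u + 1} (succIter μ a) ∧
    (∀ j, IsSmallBelow k a fun i => Iic (g j i)) ∧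
    ∀ p : Iio θ.ord → Ordinal.{u}, (∀ i, p i < (succIter (k i) a).ord) →
      ∃ j, ∃ᶠ i in clubFilterOn S, p i ≤ g j i

theorem IsSmallBelow.mono {α' : Type (u + 1)} {V : Iio θ.ord → Set α} {V' : Iio θ.ord → Set α'}
    (h : IsSmallBelow k a V) (hV : ∀ i, #(V' i) ≤ #(V i)) : IsSmallBelow k a V' :=
  h.imp (fun ⟨b, hb, h⟩ => ⟨b, hb, fun i => (hV i).trans (h i)⟩)
    fun ⟨j, h⟩ => ⟨j, fun i => (hV i).trans (h i)⟩

/-- Enumerating each `W i` in order type at most `κ_i^{+a}` turns domination of functions into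
covering of choice functions by small pieces. -/
theorem HasSmallDomination.exists_small_pieces (hdom : HasSmallDomination k μ a S)
    (hk : IsNormalApprox k μ) {W : Iio θ.ord → Set α}
    (hW : ∀ i, #(W i) ≤ lift.{u + 1} (succIter (k i) a)) :
    ∃ (J : Type (u + 1)) (V : J → Iio θ.ord → Set α), #J ≤ lift.{u + 1} (succIter μ a) ∧
      (∀ j, IsSmallBelow k a (V j)) ∧ (∀ j i, V j i ⊆ W i) ∧
      ∀ w : Iio θ.ord → α, (∀ᶠ i in clubFilterOn S, w i ∈ W i) →
        ∃ j, ∃ᶠ i in clubFilterOn S, w i ∈ V j i := by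
  classical
  choose e he heW using fun i => exists_injOn_mapsTo_Iio_ord (hW i)
  obtain ⟨J, g, hJ, hg, hdom⟩ := hdom
  refine ⟨J, fun j i => {x ∈ W i | e i x ≤ g j i}, hJ, fun j => (hg j).mono fun i => ?_,
    fun j i => sep_subset _ _, fun w hw => ?_⟩
  · rw [← mk_image_eq_of_injOn _ _ ((he i).mono (sep_subset _ _))]
    exact mk_le_mk_of_subset (image_subset_iff.2 fun x hx => hx.2)
  · obtain ⟨j, hj⟩ := hdom (fun i => if w i ∈ W i then e i (w i) else 0) fun i => by
      split_ifs with hi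
      · exact heW i hi
      · exact lt_ord.2 (by simpa using
          aleph0_pos.trans_le ((hk.aleph0_le_apply i).trans (le_succIter _ a)))
    refine ⟨j, (hj.and_eventually hw).mono ?_⟩
    rintro i ⟨hle, hi⟩
    rw [if_pos hi] at hle
    exact ⟨hi, hle⟩

theorem not_covers_of_hasSmallDomination (hk : IsNormalApprox k μ)
    (hdom : ∀ b ≤ a, ∀ S : Set (Iio θ.ord), IsStationary S → HasSmallDomination k μ b S)
    {Λ β : Type (u + 1)} [LinearOrder Λ] [WellFoundedLT Λ] [IsRegularCardinalOrder Λ]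
    [LinearOrder β] [WellFoundedLT β] (hΛ : lift.{u + 1} (succIter μ a) < #Λ)
    (hS : IsStationary S) {f : Λ → Iio θ.ord → β}
    (hf : IncreasingMod (clubFilterOn S) f)
    (hc : ∀ j, IsClubContinuous (clubFilterOn S) f (lift.{u + 1} (Order.succ (k j))))
    {W : Iio θ.ord → Set β} (hW : ∀ i, #(W i) ≤ lift.{u + 1} (succIter (k i) a)) :
    ¬ Covers (clubFilterOn S) W f := by
  have := hk.isRegularCardinalOrder
  have hτ (j) : (lift.{u + 1} (Order.succ (k j))).IsRegular :=
    (isRegular_succ (hk.aleph0_le_apply j)).lift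
  have hΘτ (j) : #(Iio θ.ord) < lift.{u + 1} (Order.succ (k j)) := by
    rw [mk_Iio_ord, Cardinal.lift_lt]
    exact (hk.lt_apply j).trans (Order.lt_succ _)
  have hτΛ (j) : lift.{u + 1} (Order.succ (k j)) < #Λ :=
    (Cardinal.lift_lt.2 ((hk.succ_lt (hk.apply_lt j)).trans_le (le_succIter _ a))).trans hΛ
  induction a using WellFoundedLT.induction generalizing S W with | ind a IH
  intro hcov
  have := (clubFilterOn_neBot_iff hk.cof_index_ne_aleph0).2 hS
  obtain ⟨J, V, hJ, hVsmall, -, hV⟩ := (hdom a le_rfl S hS).exists_small_pieces hk hW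
  obtain ⟨i₀⟩ := hk.nonempty_index
  obtain ⟨j, D, hD, hcovD⟩ := hcov.exists_covers_piece hf (hc i₀) (hτ i₀) (hΘτ i₀) (hτΛ i₀)
    (hJ.trans_lt hΛ) V hV
  rw [clubFilterOn_inf_principal] at hcovD
  replace hD : IsStationary (S ∩ D) := (frequently_clubFilterOn_iff hk.cof_index_ne_aleph0).1 hD
  have hle : clubFilterOn (S ∩ D) ≤ clubFilterOn S := clubFilterOn_mono inter_subset_left
  obtain ⟨b, hb, hVb⟩ | ⟨j', hVj'⟩ := hVsmall j
  · exact IH b hb (fun b' hb' => hdom b' (hb'.trans hb.le))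
      ((Cardinal.lift_le.2 (succIter_mono_right hb.le)).trans_lt hΛ) hD
      (hf.mono hle) (fun j => (hc j).mono hle) hVb hcovD
  · have := (clubFilterOn_neBot_iff hk.cof_index_ne_aleph0).2 hD
    exact not_covers_of_mk_lt (hf.mono hle) ((hc j').mono hle) (hτ j') (hΘτ j') (hτΛ j')
      (fun i => (hVj' i).trans_lt (Cardinal.lift_lt.2 (Order.lt_succ _))) hcovD

theorem hasSmallDomination_zero (hk : IsNormalApprox k μ) (hS : IsStationary S) :
    HasSmallDomination k μ 0 S := by
  have := hk.isRegularCardinalOrder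
  have := (clubFilterOn_neBot_iff hk.cof_index_ne_aleph0).2 hS
  refine ⟨Iio θ.ord, fun j _ => (k j).ord, ?_,
    fun j => .inr ⟨j, fun _ => mk_Iic_le_lift (card_ord _).le (hk.aleph0_le_apply j)⟩,
    fun p hp => ?_⟩
  · rw [mk_Iio_ord, Cardinal.lift_le, succIter_zero]
    exact hk.lt_limit.le
  · have hbelow (i) : ∃ j, Order.IsSuccLimit i → j < i ∧ p i < (k j).ord := by
      by_cases hi : Order.IsSuccLimit i
      · obtain ⟨j, hj, hpj⟩ := (hk.isNormal.lt_iff_exists_lt hi).1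
          (lt_ord.1 (succIter_zero (k i) ▸ hp i))
        exact ⟨j, fun _ => ⟨hj, lt_ord.2 hpj⟩⟩
      · exact ⟨i, fun h => absurd h hi⟩
    choose r hr using hbelow
    have hlim := eventually_isSuccLimit hk.aleph0_lt_mk_index S
    obtain ⟨j, hj⟩ := exists_frequently_eq_of_regressive hk.aleph0_lt_mk_index
      (hlim.mono fun i hi => (hr i hi).1).frequently
    exact ⟨j, (hj.and_eventually hlim).mono fun i hi => hi.1 ▸ (hr i hi.2).2.le⟩

theorem hasSmallDomination_of_isSuccLimit (hk : IsNormalApprox k μ) (ha : Order.IsSuccLimit a)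
    (haθ : a < θ.ord) (hS : IsStationary S) : HasSmallDomination k μ a S := by
  have := hk.isRegularCardinalOrder
  refine ⟨Iio a, fun b i => (succIter (k i) b).ord, ?_, fun b => .inl ⟨b, b.2, fun i =>
    mk_Iic_le_lift (card_ord _).le ((hk.aleph0_le_apply i).trans (le_succIter _ _))⟩,
    fun p hp => ?_⟩
  · rw [Cardinal.mk_Iio_ordinal, Cardinal.lift_le]
    exact (lt_ord.1 haθ).le.trans (hk.lt_limit.le.trans (le_succIter _ _))
  · simp only [frequently_clubFilterOn_iff hk.cof_index_ne_aleph0]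
    rw [← isStationary_iUnion_iff hk.cof_index_ne_aleph0]
    · refine hS.mono fun i hi => mem_iUnion.2 ?_
      obtain ⟨b, hb, hpb⟩ := exists_lt_succIter_of_isSuccLimit ha (lt_ord.1 (hp i))
      exact ⟨⟨b, hb⟩, hi, (lt_ord.2 hpb).le⟩
    · rw [Order.cof_eq_cardinalMk, Cardinal.lift_lt, mk_Iio_ord, Cardinal.mk_Iio_ordinal,
        Cardinal.lift_lt]
      exact lt_ord.1 haθ

theorem isDirectedMod_of_not_hasSmallDomination (hk : IsNormalApprox k μ)
    (hS : ¬ HasSmallDomination k μ (a + 1) S) :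
    IsDirectedMod (clubFilterOn S) (fun i => (succIter (k i) (a + 1)).ord)
      (lift.{u + 1} (succIter μ (a + 1))) := by
  intro J g hJ hg
  by_contra! H
  refine hS ⟨J, g, hJ, fun j => .inl ⟨a, lt_add_one a, fun i => mk_Iic_le_lift ?_ ?_⟩,
    H⟩
  · simpa [succIter_add_one, lt_ord] using hg j i
  · exact (hk.aleph0_le_apply i).trans (le_succIter _ _)

theorem exists_increasingMod_isClubContinuous_succ (hk : IsNormalApprox k μ)
    {Λ : Type (u + 1)} [LinearOrder Λ] [WellFoundedLT Λ] [IsRegularCardinalOrder Λ]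
    (hμΛ : lift.{u + 1} μ < #Λ)
    (hdir : IsDirectedMod (clubFilterOn S) (fun i => (succIter (k i) (a + 1)).ord) #Λ) :
    ∃ f : Λ → Iio θ.ord → Ordinal.{u}, (∀ z i, f z i < (succIter (k i) (a + 1)).ord) ∧
      IncreasingMod (clubFilterOn S) f ∧
      ∀ j, IsClubContinuous (clubFilterOn S) f (lift.{u + 1} (Order.succ (k j))) := by
  have := hk.noMaxOrder_index
  refine hdir.exists_increasingMod_isClubContinuous (Q := Iio θ.ord) ?_
    (fun j => (isRegular_succ (hk.aleph0_le_apply j)).lift) (fun j => ?_)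
    ((aleph0_le_lift.2 hk.aleph0_le_limit).trans hμΛ.le) fun j => ?_
  · rw [mk_Iio_ord]
    exact (Cardinal.lift_le.2 hk.lt_limit.le).trans hμΛ.le
  · rw [Order.cof_eq_cardinalMk, ← Cardinal.lift_succ]
    exact (Cardinal.lift_lt.2 (hk.succ_lt (hk.succ_lt (hk.apply_lt j)))).trans hμΛ
  · filter_upwards [mem_clubFilterOn_of_isClub (isClub_Ioi j)] with i hji
    rw [(isRegular_succIter_add_one (hk.aleph0_le_apply i) a).cof_ord, Cardinal.lift_lt,
      succIter_add_one]
    exact Order.lt_succ_of_le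
      ((Order.succ_le_of_lt (hk.isNormal.strictMono hji)).trans (le_succIter _ _))

theorem hasSmallDomination_add_one (hk : IsNormalApprox k μ)
    (hdom : ∀ b ≤ a, ∀ S : Set (Iio θ.ord), IsStationary S → HasSmallDomination k μ b S)
    (hS : IsStationary S) : HasSmallDomination k μ (a + 1) S := by
  by_contra hnot
  have hΛ : #(Iio (succIter μ (a + 1)).ord) = lift.{u + 1} (succIter μ (a + 1)) := mk_Iio_ord _
  have := isRegularCardinalOrder_Iio_ord (isRegular_succIter_add_one hk.aleph0_le_limit a)
  have hlt : lift.{u + 1} (succIter μ a) < #(Iio (succIter μ (a + 1)).ord) := by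
    rw [hΛ, Cardinal.lift_lt]
    exact succIter_lt_succIter (lt_add_one a)
  have hμΛ : lift.{u + 1} μ < #(Iio (succIter μ (a + 1)).ord) :=
    (Cardinal.lift_le.2 (le_succIter μ a)).trans_lt hlt
  have hdir := isDirectedMod_of_not_hasSmallDomination hk hnot
  rw [← hΛ] at hdir
  obtain ⟨f, hfl, hf, hc⟩ := exists_increasingMod_isClubContinuous_succ hk hμΛ hdir
  obtain ⟨h, hh, hfh⟩ := hdir _ f le_rfl hfl
  have hW (i) : #(Iio (h i)) ≤ lift.{u + 1} (succIter (k i) a) := by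
    rw [Cardinal.mk_Iio_ordinal, Cardinal.lift_le]
    simpa [succIter_add_one, lt_ord] using hh i
  refine not_covers_of_hasSmallDomination hk hdom hlt hS hf hc hW fun z => ?_
  have := noMaxOrder_of_aleph0_le ((aleph0_le_lift.2 hk.aleph0_le_limit).trans hμΛ.le)
  obtain ⟨z', hz'⟩ := exists_gt z
  exact ⟨z', ((hfh z).and (hf hz')).mono fun i hi => ⟨f z i, hi.1, le_rfl, hi.2⟩⟩

theorem hasSmallDomination (hk : IsNormalApprox k μ) (ha : a < θ.ord) (hS : IsStationary S) :
    HasSmallDomination k μ a S := by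
  induction a using WellFoundedLT.induction generalizing S with | ind a IH
  obtain rfl | ⟨b, rfl⟩ | ha' := Ordinal.zero_or_succ_or_isSuccLimit a
  · exact hasSmallDomination_zero hk hS
  · refine hasSmallDomination_add_one hk (fun b' hb' S hS => ?_) hS
    exact IH b' (Order.lt_succ_of_le hb') ((Order.lt_succ_of_le hb').trans ha) hS
  · exact hasSmallDomination_of_isSuccLimit hk ha' ha hS

end Domination

section AlmostDisjoint

variable {ι α : Type (u + 1)} {θ μ c : Cardinal.{u}} {L : Cardinal.{u + 1}}
  {k : Iio θ.ord → Cardinal.{u}} {a : Ordinal.{u}} {A : Set (Set Ordinal.{u})}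
  {D : Iio θ.ord → Set (Set Ordinal.{u})} {S : Set (Iio θ.ord)}

theorem exists_isDenseIn_mk_eq_density {P : Type u} [PartialOrder P] (B : Set P) :
    ∃ E ⊆ B, IsDenseIn E B ∧ #E = density B :=
  csInf_mem (s := {c | ∃ E : Set P, E ⊆ B ∧ IsDenseIn E B ∧ #E = c})
    ⟨#B, B, subset_rfl, fun y hy => ⟨y, hy, le_rfl⟩, rfl⟩

theorem mk_iUnion_le_of_le {X : ι → Set α} (hL : ℵ₀ ≤ L) (hι : #ι ≤ L)
    (hX : ∀ i, #(X i) ≤ L) : #(⋃ i, X i) ≤ L :=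
  (mk_iUnion_le X).trans (mul_le_of_le hL hι (ciSup_le' hX))

theorem mk_le_lowerDensity_of_pairwise_mk_inter_lt (hc : c < μ) {R : Set α}
    (hR : #R ≤ lift.{u + 1} c) {G : ι → Set α} (hGR : ∀ x, G x ⊆ R)
    (hG : ∀ x, #(G x) = lift.{u + 1} θ)
    (hdisj : Pairwise fun x y => #(G x ∩ G y : Set α) < lift.{u + 1} θ) :
    #ι ≤ lowerDensity μ θ := by
  obtain ⟨e, he, heR⟩ := exists_injOn_mapsTo_Iio_ord hR
  have hcμ : c.ord < μ.ord := ord_lt_ord.2 hc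
  have hlower (x) : e '' G x ∈ lowerSubsets μ θ := by
    have hsub : e '' G x ⊆ Iio c.ord := (image_mono (hGR x)).trans heR.image_subset
    refine ⟨⟨hsub.trans (Iio_subset_Iio hcμ.le), ?_⟩, c.ord, hcμ, hsub⟩
    rw [mk_image_eq_of_injOn _ _ (he.mono (hGR x)), hG]
  obtain ⟨E, hE, hdense, hcard⟩ := exists_isDenseIn_mk_eq_density (lowerSubsets μ θ)
  choose Z hZE hZG using fun x => hdense (e '' G x) (hlower x)
  rw [lowerDensity, ← hcard]
  refine mk_le_of_injective (f := fun x => (⟨Z x, hZE x⟩ : E)) fun x y hxy => ?_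
  by_contra hne
  have hZ : Z x = Z y := congrArg Subtype.val hxy
  have hsub : Z x ⊆ e '' (G x ∩ G y) := by
    rw [he.image_inter (hGR x) (hGR y)]
    exact subset_inter (hZG x) (hZ ▸ hZG y)
  have hlt := ((mk_le_mk_of_subset hsub).trans mk_image_le).trans_lt (hdisj hne)
  exact hlt.ne (hE (hZE x)).1.2

/-- A member `X` of `A` is represented by the graph of a function choosing a subset of `X` in each
`D i` which has one. Different members have graphs with a bounded intersection. -/
theorem mk_le_lowerDensity_of_isCofinal (hk : IsNormalApprox k μ)
    (hA : A.Pairwise fun X Y => ∃ a < μ.ord, X ∩ Y ⊆ Iio a)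
    (hD : ∀ i, ∀ Y ∈ D i, ∀ a < (k i).ord, ∃ y ∈ Y, a ≤ y) (hc : c < μ)
    (hDc : ∀ i, #(D i) ≤ lift.{u + 1} c) (hcof : ∀ X ∈ A, IsCofinal {i | ∃ Y ∈ D i, Y ⊆ X}) :
    #A ≤ lowerDensity μ θ := by
  have := hk.isRegularCardinalOrder
  choose! Y hYD hYX using fun (X : Set Ordinal.{u}) i (h : ∃ Y ∈ D i, Y ⊆ X) => h
  let pt (X : Set Ordinal.{u}) (i : Iio θ.ord) : Iio θ.ord × Set Ordinal.{u} := (i, Y X i)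
  have hpt (X) : Function.Injective (pt X) := fun i j hij => congrArg Prod.fst hij
  have hR : #(⋃ i, Prod.mk i '' D i) ≤ lift.{u + 1} (max θ c) := by
    refine mk_iUnion_le_of_le ?_ ?_ fun i => mk_image_le.trans ((hDc i).trans ?_)
    · exact aleph0_le_lift.2 (hk.aleph0_lt.le.trans (le_max_left _ _))
    · rw [mk_Iio_ord]
      exact Cardinal.lift_le.2 (le_max_left _ _)
    · exact Cardinal.lift_le.2 (le_max_right _ _)
  refine mk_le_lowerDensity_of_pairwise_mk_inter_lt (max_lt hk.lt_limit hc) hR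
    (G := fun X : A => pt X '' {i | ∃ Y ∈ D i, Y ⊆ X}) ?_ (fun X => ?_) fun X X' hne => ?_
  · rintro X _ ⟨i, hi, rfl⟩
    exact mem_iUnion.2 ⟨i, _, hYD X i hi, rfl⟩
  · rw [mk_image_eq (hpt X), ← mk_Iio_ord]
    refine (mk_set_le _).antisymm ?_
    rw [← Order.cof_eq_cardinalMk]
    exact Order.cof_le (hcof X X.2)
  · obtain ⟨a, ha, hXX'⟩ := hA X.2 X'.2 (Subtype.coe_injective.ne hne)
    obtain ⟨i₀, hi₀⟩ := hk.exists_lt_apply (lt_ord.1 ha)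
    have hsub : pt X '' {i | ∃ Y ∈ D i, Y ⊆ X} ∩ pt X' '' {i | ∃ Y ∈ D i, Y ⊆ X'} ⊆
        pt X '' Iio i₀ := by
      rintro _ ⟨⟨i, hi, rfl⟩, i', hi', heq⟩
      obtain rfl : i' = i := congrArg Prod.fst heq
      have hYY : Y X' i' = Y X i' := congrArg Prod.snd heq
      refine ⟨i', mem_Iio.2 (not_le.1 fun hle => ?_), rfl⟩
      obtain ⟨y, hy, hay⟩ := hD i' _ (hYD X i' hi) a
        ((lt_ord.2 hi₀).trans_le (ord_le_ord.2 (hk.isNormal.strictMono.monotone hle)))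
      exact hay.not_gt (hXX' ⟨hYX X i' hi hy, hYX X' i' hi' (hYY ▸ hy)⟩)
    refine ((mk_le_mk_of_subset hsub).trans mk_image_le).trans_lt ((mk_Iio_lt_cof i₀).trans_eq ?_)
    rw [Order.cof_eq_cardinalMk, mk_Iio_ord]

theorem exists_covering_of_hasSmallDomination (hk : IsNormalApprox k μ)
    (hdom : ∀ T ⊆ S, IsStationary T → HasSmallDomination k μ a T)
    (hDa : ∀ i, #(D i) ≤ lift.{u + 1} (succIter (k i) a))
    (hst : ∀ X ∈ A, IsStationary {i ∈ S | ∃ Y ∈ D i, Y ⊆ X})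
    (hS : density {T | T ⊆ S ∧ IsStationary T} ≤ L)
    (hμ : lift.{u + 1} (succIter μ a) ≤ L) :
    ∃ (ι : Type (u + 1)) (V : ι → Iio θ.ord → Set (Set Ordinal.{u})), #ι ≤ L ∧
      (∀ x, IsSmallBelow k a (V x)) ∧ (∀ x i, V x i ⊆ D i) ∧
      ∀ X ∈ A, ∃ x, IsStationary {i ∈ S | ∃ Y ∈ V x i, Y ⊆ X} := by
  choose! Y hYD hYX using fun (X : Set Ordinal.{u}) i (h : ∃ Y ∈ D i, Y ⊆ X) => h
  obtain ⟨E, hE, hdense, hcard⟩ := exists_isDenseIn_mk_eq_density {T | T ⊆ S ∧ IsStationary T}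
  choose J V hJ hV hVD hcov using fun T : E =>
    (hdom T (hE T.2).1 (hE T.2).2).exists_small_pieces hk hDa
  refine ⟨Σ T, J T, fun x => V x.1 x.2, ?_, fun x => hV _ _, fun x => hVD _ _, fun X hX => ?_⟩
  · rw [mk_sigma]
    refine (sum_le_sum _ _ fun T => (hJ T).trans hμ).trans ?_
    rw [sum_const, Cardinal.lift_id, Cardinal.lift_id]
    exact mul_le_of_le ((hk.aleph0_le_lift_succIter a).trans hμ) (hcard.le.trans hS) le_rfl
  · obtain ⟨T, hT, hTX⟩ := hdense _ ⟨sep_subset _ _, hst X hX⟩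
    have hmem : ∀ᶠ i in clubFilterOn T, i ∈ T := mem_inf_of_right (mem_principal_self T)
    obtain ⟨j, hj⟩ := hcov ⟨T, hT⟩ (Y X) (hmem.mono fun i hi => hYD X i (hTX hi).2)
    refine ⟨⟨⟨T, hT⟩, j⟩, ((frequently_clubFilterOn_iff hk.cof_index_ne_aleph0).1 hj).mono ?_⟩
    rintro i ⟨hi, hiV⟩
    exact ⟨(hTX hi).1, Y X i, hiV, hYX X i (hTX hi).2⟩

theorem mk_le_of_isStationary (hk : IsNormalApprox k μ)
    (hμ : lowerDensity μ θ ≤ L) (hS : density {T | T ⊆ S ∧ IsStationary T} ≤ L)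
    (hA : A.Pairwise fun X Y => ∃ a < μ.ord, X ∩ Y ⊆ Iio a)
    (hD : ∀ i, ∀ Y ∈ D i, ∀ a < (k i).ord, ∃ y ∈ Y, a ≤ y) (ha : a < θ.ord)
    (haL : lift.{u + 1} (succIter μ a) ≤ L)
    (hDa : ∀ i, #(D i) ≤ lift.{u + 1} (succIter (k i) a))
    (hst : ∀ X ∈ A, IsStationary {i ∈ S | ∃ Y ∈ D i, Y ⊆ X}) : #A ≤ L := by
  induction a using WellFoundedLT.induction generalizing D A with | ind a IH
  have hL : ℵ₀ ≤ L := (hk.aleph0_le_lift_succIter a).trans haL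
  obtain ⟨ι, V, hι, hV, hVD, hcov⟩ := exists_covering_of_hasSmallDomination hk
    (fun T _ => hasSmallDomination hk ha) hDa hst hS haL
  have hsub : A ⊆ ⋃ x, {X ∈ A | IsStationary {i ∈ S | ∃ Y ∈ V x i, Y ⊆ X}} := fun X hX =>
    have ⟨x, hx⟩ := hcov X hX
    mem_iUnion.2 ⟨x, hX, hx⟩
  refine (mk_le_mk_of_subset hsub).trans (mk_iUnion_le_of_le hL hι fun x => ?_)
  have hVY (i) (Y) (hY : Y ∈ V x i) := hD i Y (hVD x i hY)
  obtain ⟨b, hb, hVb⟩ | ⟨j, hVj⟩ := hV x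
  · exact IH b hb (hA.mono (sep_subset _ _)) hVY (hb.trans ha)
      ((Cardinal.lift_le.2 (succIter_mono_right hb.le)).trans haL) hVb fun X hX => hX.2
  · have := hk.isRegularCardinalOrder
    have := hk.noMaxOrder_index
    exact (mk_le_lowerDensity_of_isCofinal hk (hA.mono (sep_subset _ _)) hVY (hk.apply_lt j) hVj
      fun X hX => isCofinal_of_isStationary (hX.2.mono fun i hi => hi.2)).trans hμ

end AlmostDisjoint

section Antichain

variable {θ μ : Cardinal.{u}} {A : Set (Set Ordinal.{u})}

theorem exists_ge_of_mem_upperSubsets {Y : Set Ordinal.{u}} (hY : Y ∈ upperSubsets μ θ)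
    {a : Ordinal.{u}} (ha : a < μ.ord) : ∃ y ∈ Y, a ≤ y := by
  by_contra! H
  have hlt := hY.2 a ha
  rw [(inter_eq_left.2 H : Y ∩ Iio a = Y), hY.1.2] at hlt
  exact hlt.false

theorem IsAntichainIn.pairwise_inter_subset_Iio (hA : IsAntichainIn A (upperSubsets μ μ.ord.cof))
    (hμ : ℵ₀ ≤ μ) : A.Pairwise fun X Y => ∃ a < μ.ord, X ∩ Y ⊆ Iio a := by
  intro X hX Y hY hne
  have hXmem := hA.1 hX
  have hsub : X ∩ Y ⊆ Iio μ.ord := inter_subset_left.trans hXmem.1.1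
  have hlt : #(X ∩ Y : Set Ordinal.{u}) < lift.{u + 1} μ.ord.cof := by
    refine ((mk_le_mk_of_subset inter_subset_left).trans hXmem.1.2.le).lt_of_ne fun heq => ?_
    refine hA.2 X hX Y hY hne ⟨X ∩ Y, ⟨⟨hsub, heq⟩, fun a ha => ?_⟩,
      inter_subset_left, inter_subset_right⟩
    exact (mk_le_mk_of_subset (inter_subset_inter_left _ inter_subset_left)).trans_lt
      (hXmem.2 a ha)
  have hsSup : sSup (X ∩ Y) < μ.ord :=
    Ordinal.sSup_lt_of_lt_cof (by rwa [← Ordinal.lift_cof]) hsub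
  exact ⟨_, (isSuccLimit_ord hμ).succ_lt hsSup, fun x hx =>
    Order.lt_succ_of_le (le_csSup ⟨μ.ord, fun y hy => (hsub hy).le⟩ hx)⟩

end Antichain

end DensityArithmetic

open DensityArithmetic in
theorem theorem2p6_general {θ μ : Cardinal.{u}} {k : Iio θ.ord → Cardinal.{u}}
    (hk : IsNormalApprox k μ) {A : Set (Set Ordinal.{u})}
    (hA : A.Pairwise fun X Y => ∃ a < μ.ord, X ∩ Y ⊆ Iio a) {γ : Ordinal.{u}} (hγ : γ < θ.ord)
    {S : Set (Iio θ.ord)} {D : S → Set (Set Ordinal.{u})}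
    (hD : ∀ i, ∀ Y ∈ D i, ∀ a < (k i).ord, ∃ y ∈ Y, a ≤ y)
    (hDγ : ∀ i, #(D i) ≤ lift.{u + 1} (succIter (k i) γ))
    (hst : ∀ X ∈ A, IsStationary {i | ∃ hi : i ∈ S, ∃ Y ∈ D ⟨i, hi⟩, Y ⊆ X}) :
    #A ≤ lift.{u + 1} (succIter μ γ) + lowerDensity μ θ +
      density {T | T ⊆ S ∧ IsStationary T} := by
  refine mk_le_of_isStationary hk (D := fun i => {Y | ∃ hi : i ∈ S, Y ∈ D ⟨i, hi⟩})
    (le_add_self.trans le_self_add) le_add_self hA (fun i Y ⟨hi, hY⟩ => hD ⟨i, hi⟩ Y hY) hγ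
    (le_self_add.trans le_self_add) (fun i => ?_) fun X hX => (hst X hX).mono ?_
  · by_cases hi : i ∈ S
    · have hsub : {Y | ∃ hi : i ∈ S, Y ∈ D ⟨i, hi⟩} ⊆ D ⟨i, hi⟩ := fun _ ⟨_, hY⟩ => hY
      exact (mk_le_mk_of_subset hsub).trans (hDγ ⟨i, hi⟩)
    · simp [hi]
  · rintro i ⟨hi, Y, hY, hYX⟩
    exact ⟨hi, Y, ⟨hi, hY⟩, hYX⟩

theorem theorem2p6 (κ θ μ : Cardinal.{u}) (hκ : κ.IsRegular) (hκθ : κ < θ)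
    (hθ : θ = μ.ord.cof) (hθμ : θ < μ)
    (k : Iio θ.ord → Cardinal.{u}) (hk : Order.IsNormal k) (hkμ : IsLUB (range k) μ)
    (hθk : ∀ i, θ < k i)
    (A : Set (Set Ordinal.{u}))
    (hA : DensityArithmetic.IsAntichainIn A (DensityArithmetic.upperSubsets μ θ))
    (γ : Ordinal.{u}) (hγ : γ < θ.ord)
    (hD : ∃ D : DensityArithmetic.cofSet θ κ → Set (Set Ordinal.{u}),
      (∀ i, D i ⊆ DensityArithmetic.upperSubsets (k i) κ ∧
        #(D i) ≤ lift.{u + 1} (DensityArithmetic.succIter (k i) γ)) ∧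
      ∀ X ∈ A, IsStationary
        {i : Iio θ.ord | ∃ hi : i ∈ DensityArithmetic.cofSet θ κ, ∃ Y ∈ D ⟨i, hi⟩, Y ⊆ X}) :
    #A ≤ lift.{u + 1} (DensityArithmetic.succIter μ γ) +
      DensityArithmetic.lowerDensity μ θ +
      DensityArithmetic.density (DensityArithmetic.stationarySubsets θ κ) := by
  subst hθ
  obtain ⟨D, hD, hst⟩ := hD
  have hθ0 : ℵ₀ < μ.ord.cof := hκ.aleph0_le.trans_lt hκθ
  have hμ : ℵ₀ ≤ μ := (hθ0.trans hθμ).le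
  have happrox : DensityArithmetic.IsNormalApprox k μ :=
    ⟨isRegular_cof (isSuccLimit_ord hμ), hθ0, hk, hkμ, hθk⟩
  exact theorem2p6_general happrox
    (hA.pairwise_inter_subset_Iio hμ) hγ
    (fun i Y hY _ => DensityArithmetic.exists_ge_of_mem_upperSubsets ((hD i).1 hY))
    (fun i => (hD i).2) hst
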